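/- Let $d\ge 1$, $N\ge 1$ and let $\mathcal A_1,\dots,\mathcal A_N$ be nonempty finite subsets of the closed Euclidean unit ball of $\mathbb R^d$. Put $\mathcal B=\bigcup_{n\le N}\{a-a' : a,a'\in\mathcal A_n\}$ and assume $\operatorname{Span}(\mathcal B)=\mathbb R^d$. For a probability distribution (design) $\pi$ on $\mathcal B$ let $V(\pi)=\sum_{b\in\mathcal B}\pi(b)\,bb^\top$ and $g(\pi)=\max_{b\in\mathcal B} b^\top V(\pi)^{-1}b$ (with $g(\pi)=+\infty$ if $V(\pi)$ is singular). Let $\pi^\star$ be an optimal design, i.e. a minimizer of $g$, let $\epsilon>0$, and let $\hat\pi$ be a design with $g(\hat\pi)\le(1+\epsilon)\,g(\pi^\star)$. Let $T\ge d^2$ be an integer, $\lambda>0$, $\delta\in(0,1)$ and $\theta^\star\in\mathbb R^d$ with $\|\theta^\star\|_2\le 1$. ODPO selects, in some order, pairs $(a^{\ell}_t,a^{m}_t)_{t=1,\dots,M}$, the two members of each pair lying in a common $\mathcal A_n$, so that every $b\in\mathcal B$ occurs as a difference $B_t=a^{\ell}_t-a^{m}_t$ exactly $\lceil T\hat\pi(b)\rceil$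 times (so $M=\sum_{b\in\mathcal B}\lceil T\hat\pi(b)\rceil\ge T$). It then receives labels $Y_t\in\{0,1\}$, adapted to a filtration $(\mathcal F_t)$, with $\mathbb P(Y_t=1\mid\mathcal F_{t-1})=\sigma(\langle\theta^\star,B_t\rangle)$, where $\sigma(x)=1/(1+e^{-x})$. Let - $\hat\theta$ be a maximizer over $\mathbb R^d$ of $\sum_{t}\bigl[Y_t\log\sigma(\langle\theta,B_t\rangle)+(1-Y_t)\log\sigma(-\langle\theta,B_t\rangle)\bigr]-\tfrac{\lambda}{2}\|\theta\|_2^2$; - $\hat\theta^P$ be a minimizer over the closed unit ball of $\theta\mapsto\|H(\theta)-H(\hat\theta)\|_{V^{-1}}$, where $H(\theta)=\lambda\theta+\sum_t\sigma(\langle\theta,B_t\rangle)B_t$, $V=\lambda I+\sum_t B_tB_t^\top$ and $\|x\|_{M}=\sqrt{x^\top Mx}$; - $\hat a(\mathcal A_n)\in\operatorname{argmax}_{a\in\mathcal A_n}\langle\hat\theta^P,a\rangle$ for every $n\le N$. Then, with probability at least $1-\delta$ (and whatever the choice among possible ties in these three steps), $$\max_{n\le N}\max_{a\in\mathcal A_n}\langle\theta^\star,a-\hat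 a(\mathcal A_n)\rangle\le 20(1+\epsilon)\sqrt{\frac dT}\left[\sqrt{2\log(1/\delta)+d\log\Bigl(\lambda^{1-1/d}+\frac{4T}{d\,\lambda^{1/d}}\Bigr)}+\sqrt\lambda\right].$$ -/

import Mathlib

open MeasureTheory ProbabilityTheory
open scoped ENNReal RealInnerProductSpace

namespace ODPO

noncomputable section

/-- The embedding space `ℝ^d` with its Euclidean structure. -/
abbrev Vec (d : ℕ) : Type := EuclideanSpace ℝ (Fin d)

/-- The rank-one matrix `x xᵀ`. -/
def outer {d : ℕ} (x : Vec d) : Matrix (Fin d) (Fin d) ℝ :=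
  Matrix.vecMulVec x.ofLp x.ofLp

/-- The quadratic form `xᵀ M x`, i.e. `‖x‖_M ^ 2`. -/
def quad {d : ℕ} (M : Matrix (Fin d) (Fin d) ℝ) (x : Vec d) : ℝ :=
  x.ofLp ⬝ᵥ M.mulVec x.ofLp

/-- The weighted norm `‖x‖_M = √(xᵀ M x)`. -/
def wnorm {d : ℕ} (M : Matrix (Fin d) (Fin d) ℝ) (x : Vec d) : ℝ :=
  Real.sqrt (quad M x)

/-! ### Action sets, differences and designs -/

open Classical in
/-- The set `𝓑 = ⋃ₙ (𝓐ₙ - 𝓐ₙ)` of differences of two actions with the same prompt. -/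
def diffs {d N : ℕ} (A : Fin N → Finset (Vec d)) : Finset (Vec d) :=
  Finset.univ.biUnion fun n => (A n ×ˢ A n).image fun p => p.1 - p.2

/-- The information matrix `V(π) = ∑_{b ∈ 𝓑} π(b) b bᵀ`. -/
def infoMatrix {d : ℕ} {B : Finset (Vec d)} (π : B → ℝ) : Matrix (Fin d) (Fin d) ℝ :=
  ∑ b : B, π b • outer (b : Vec d)

open Classical in
/-- `g(π) = max_{b ∈ 𝓑} ‖b‖²_{V(π)⁻¹}`, with the usual convention `g(π) = +∞` when `V(π)` is
singular. -/
def gValue {d : ℕ} {B : Finset (Vec d)} (π : B → ℝ) : ℝ≥0∞ :=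
  if IsUnit (infoMatrix π).det then
    ⨆ b : B, ENNReal.ofReal (quad (infoMatrix π)⁻¹ (b : Vec d))
  else ⊤

/-- `π` is an optimal design: a probability distribution on `𝓑` that minimizes `g`. -/
def IsOptimalDesign {d : ℕ} {B : Finset (Vec d)} (π : B → ℝ) : Prop :=
  π ∈ stdSimplex ℝ B ∧ ∀ π' ∈ stdSimplex ℝ B, gValue π ≤ gValue π'

/-- `πhat` is a `(1 + ε)`-approximation of the design `πstar`. -/
def IsApproxDesign {d : ℕ} {B : Finset (Vec d)} (ε : ℝ) (πstar πhat : B → ℝ) : Prop :=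
  πhat ∈ stdSimplex ℝ B ∧ gValue πhat ≤ ENNReal.ofReal (1 + ε) * gValue πstar

open Classical in
/-- The pairs `(al t, am t)`, `t < m`, form a dataset selected by ODPO with budget `T` and design
`πhat`: both members of a pair belong to a common action set, and every difference `b ∈ 𝓑` is
selected exactly `⌈T πhat(b)⌉` times (in any order). -/
def IsSelected {d N : ℕ} (A : Fin N → Finset (Vec d)) (T : ℕ) (πhat : diffs A → ℝ)
    {m : ℕ} (al am : Fin m → Vec d) : Prop :=
  (∀ t, ∃ n, al t ∈ A n ∧ am t ∈ A n) ∧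
    ∀ b : diffs A,
      (Finset.univ.filter fun t => al t - am t = (b : Vec d)).card = ⌈(T : ℝ) * πhat b⌉₊

/-! ### Preference labels -/

/-- `Y t` is the label of the duel between `al t` and `am t` in the Bradley-Terry model with
parameter `θ`: it takes the values `0` and `1`, is known after round `t`, and, conditionally on the
past `ℱ t`, the probability of `Y t = 1` is `σ(⟪θ, al t - am t⟫)`. -/
structure IsPreferenceFeedback {Ω : Type*} [mΩ : MeasurableSpace Ω] (P : Measure Ω)
    (ℱ : Filtration ℕ mΩ) {d m : ℕ} (θ : Vec d) (al am : Fin m → Vec d)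
    (Y : Fin m → Ω → ℝ) : Prop where
  zero_or_one : ∀ t ω, Y t ω = 0 ∨ Y t ω = 1
  measurable : ∀ t : Fin m, Measurable[ℱ ((t : ℕ) + 1)] (Y t)
  cond_prob : ∀ t : Fin m,
    P⟦Y t ⁻¹' {1} | ℱ (t : ℕ)⟧ =ᵐ[P] fun _ => Real.sigmoid ⟪θ, al t - am t⟫

/-! ### Estimators -/

/-- The regularized log-likelihood of `θ` given the pairs and their labels `y`. -/
def logLik {d m : ℕ} (lam : ℝ) (al am : Fin m → Vec d) (y : Fin m → ℝ) (θ : Vec d) : ℝ :=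
  ∑ t, (y t * Real.log (Real.sigmoid ⟪θ, al t - am t⟫) +
      (1 - y t) * Real.log (Real.sigmoid (-⟪θ, al t - am t⟫))) - lam * ‖θ‖ ^ 2 / 2

/-- `θhat` is a maximum likelihood estimator: it maximizes the regularized log-likelihood over the
whole space. -/
def IsMLE {d m : ℕ} (lam : ℝ) (al am : Fin m → Vec d) (y : Fin m → ℝ) (θhat : Vec d) : Prop :=
  ∀ θ, logLik lam al am y θ ≤ logLik lam al am y θhat

/-- `H(θ) = λ θ + ∑ₜ σ(⟪θ, al t - am t⟫) (al t - am t)`. -/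
def hMap {d m : ℕ} (lam : ℝ) (al am : Fin m → Vec d) (θ : Vec d) : Vec d :=
  lam • θ + ∑ t, Real.sigmoid ⟪θ, al t - am t⟫ • (al t - am t)

/-- The regularized design matrix `V = λ I + ∑ₜ (al t - am t) (al t - am t)ᵀ`. -/
def designMatrix {d m : ℕ} (lam : ℝ) (al am : Fin m → Vec d) : Matrix (Fin d) (Fin d) ℝ :=
  lam • (1 : Matrix (Fin d) (Fin d) ℝ) + ∑ t, outer (al t - am t)

/-- `θP` is a projected MLE: it minimizes `‖H(θ) - H(θhat)‖_{V⁻¹}` over the closed unit ball. -/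
def IsProjectedMLE {d m : ℕ} (lam : ℝ) (al am : Fin m → Vec d) (θhat θP : Vec d) : Prop :=
  ‖θP‖ ≤ 1 ∧ ∀ θ : Vec d, ‖θ‖ ≤ 1 →
    wnorm (designMatrix lam al am)⁻¹ (hMap lam al am θP - hMap lam al am θhat) ≤
      wnorm (designMatrix lam al am)⁻¹ (hMap lam al am θ - hMap lam al am θhat)

/-- `ahat n` is a greedy choice for `θ` in each `𝓐ₙ`: `ahat n ∈ argmax_{a ∈ 𝓐ₙ} ⟪θ, a⟫`. -/
def IsGreedy {d N : ℕ} (A : Fin N → Finset (Vec d)) (θ : Vec d) (ahat : Fin N → Vec d) : Prop :=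
  ∀ n, ahat n ∈ A n ∧ ∀ a ∈ A n, ⟪θ, a⟫ ≤ ⟪θ, ahat n⟫

/-- The simple regret `max_n max_{a ∈ 𝓐ₙ} ⟪θ, a - ahat n⟫` (finite maxima). -/
def simpleRegret {d N : ℕ} (A : Fin N → Finset (Vec d)) (θ : Vec d) (ahat : Fin N → Vec d) : ℝ :=
  ⨆ n : Fin N, ⨆ a : A n, ⟪θ, (a : Vec d) - ahat n⟫

end

end ODPO

namespace ODPO

/-! ### Quadratic forms -/

section LinearAlgebra

variable {d : ℕ}

open Matrix

/-! Write `B_t` for the selected differences and `S` for the score at `θ⋆`. Greediness for `θP` and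
Cauchy-Schwarz bound each regret `⟪θ⋆, a - â⟫` by `‖a - â‖_{V⁻¹} ‖θ⋆ - θP‖_V`.

The first factor is a design question. Rounding up gives `V ⪰ T V(πhat)`, so `‖b‖²_{V⁻¹} ≤ g(πhat) /
T`, and Kiefer-Wolfowitz (`exists_gValue_le`) gives `g(πhat) ≤ (1 + ε) d`.

For the second, `H` is strongly monotone on the unit ball relative to `V`, with constant `100/953`,
a lower bound for `σ'` on `[-2, 2]`. Projection costs a factor 2, and the likelihood equation gives
`H(θ⋆) - H(θhat) = λ θ⋆ - S`; hence `‖θ⋆ - θP‖_V ≤ (953/50) (‖S‖_{V⁻¹} + √λ)`.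

The pairs are not random, so neither is `V`, and mixing exponential moments of `S` over the Gaussian
`N(0, V⁻¹)` yields `E exp(‖S‖²_{V⁻¹} / 2) ≤ (4/3)^{d/2}`. Markov's inequality then gives `‖S‖²_{V⁻¹}
≤ 2 log(1/δ) + d log(4/3)`. A numerical comparison (`confidence_width_le`) replaces `log(4/3)` by
the stated logarithm, using the gap between `953/50` and `20`. -/

theorem inner_eq_dotProduct (x y : Vec d) : ⟪x, y⟫ = x.ofLp ⬝ᵥ y.ofLp := by
  rw [EuclideanSpace.inner_eq_star_dotProduct, star_trivial, dotProduct_comm]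

theorem quad_add_matrix (M W : Matrix (Fin d) (Fin d) ℝ) (x : Vec d) :
    quad (M + W) x = quad M x + quad W x := by
  simp [quad, add_mulVec, dotProduct_add]

theorem quad_smul_matrix (c : ℝ) (M : Matrix (Fin d) (Fin d) ℝ) (x : Vec d) :
    quad (c • M) x = c * quad M x := by
  simp [quad, smul_mulVec, dotProduct_smul]

theorem quad_sum_matrix {ι : Type*} (s : Finset ι) (M : ι → Matrix (Fin d) (Fin d) ℝ)
    (x : Vec d) : quad (∑ i ∈ s, M i) x = ∑ i ∈ s, quad (M i) x := by
  simp [quad, sum_mulVec, dotProduct_sum]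

theorem quad_outer (b x : Vec d) : quad (outer b) x = ⟪x, b⟫ ^ 2 := by
  rw [quad, outer, vecMulVec_mulVec, inner_eq_dotProduct]
  simp [dotProduct_comm b.ofLp, sq]

theorem quad_one (x : Vec d) : quad (1 : Matrix (Fin d) (Fin d) ℝ) x = ‖x‖ ^ 2 := by
  rw [quad, one_mulVec, ← inner_eq_dotProduct, real_inner_self_eq_norm_sq]

theorem quad_smul (c : ℝ) (M : Matrix (Fin d) (Fin d) ℝ) (x : Vec d) :
    quad M (c • x) = c ^ 2 * quad M x := by
  simp [quad, mulVec_smul]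
  ring

theorem quad_neg (M : Matrix (Fin d) (Fin d) ℝ) (x : Vec d) : quad M (-x) = quad M x := by
  simp [quad, mulVec_neg]

theorem wnorm_neg (M : Matrix (Fin d) (Fin d) ℝ) (x : Vec d) : wnorm M (-x) = wnorm M x := by
  rw [wnorm, wnorm, quad_neg]

theorem posSemidef_outer (b : Vec d) : (outer b).PosSemidef := by
  have := posSemidef_vecMulVec_self_star b.ofLp
  rwa [star_trivial] at this

theorem _root_.Matrix.PosSemidef.quad_nonneg {M : Matrix (Fin d) (Fin d) ℝ} (hM : M.PosSemidef)
    (x : Vec d) : 0 ≤ quad M x := by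
  simpa [quad] using hM.dotProduct_mulVec_nonneg x.ofLp

theorem _root_.Matrix.PosDef.quad_pos {M : Matrix (Fin d) (Fin d) ℝ} (hM : M.PosDef)
    {x : Vec d} (hx : x ≠ 0) : 0 < quad M x := by
  have : x.ofLp ≠ 0 := fun h => hx (by ext i; simp [h])
  simpa [quad] using hM.dotProduct_mulVec_pos this

theorem _root_.Matrix.PosSemidef.posDef_of_quad_ne_zero {M : Matrix (Fin d) (Fin d) ℝ}
    (hM : M.PosSemidef) (h : ∀ x : Vec d, quad M x = 0 → x = 0) : M.PosDef := by
  refine .of_dotProduct_mulVec_pos hM.isHermitian fun x hx => ?_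
  have h0 := hM.quad_nonneg (WithLp.toLp 2 x)
  rw [star_trivial]
  refine lt_of_le_of_ne h0 fun h1 => hx ?_
  have := h _ h1.symm
  simpa using this

theorem _root_.Matrix.PosDef.mulVec_inv_mulVec {M : Matrix (Fin d) (Fin d) ℝ} (hM : M.PosDef)
    (v : Fin d → ℝ) : M *ᵥ (M⁻¹ *ᵥ v) = v := by
  rw [mulVec_mulVec, mul_nonsing_inv _ ((isUnit_iff_isUnit_det _).1 hM.isUnit), one_mulVec]

theorem _root_.Matrix.IsHermitian.dotProduct_mulVec_comm {M : Matrix (Fin d) (Fin d) ℝ}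
    (hM : M.IsHermitian) (v w : Fin d → ℝ) : v ⬝ᵥ M *ᵥ w = w ⬝ᵥ M *ᵥ v := by
  have hT : Mᵀ = M := by simpa [IsHermitian, conjTranspose_eq_transpose_of_trivial] using hM
  rw [dotProduct_mulVec, ← mulVec_transpose, hT, dotProduct_comm]

theorem quad_add {M : Matrix (Fin d) (Fin d) ℝ} (hM : M.IsHermitian) (x y : Vec d) :
    quad M (x + y) = quad M x + 2 * (x.ofLp ⬝ᵥ M *ᵥ y.ofLp) + quad M y := by
  have := hM.dotProduct_mulVec_comm y.ofLp x.ofLp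
  simp only [quad, WithLp.ofLp_add, mulVec_add, dotProduct_add, add_dotProduct]
  linarith

/-- The Cauchy-Schwarz inequality for a positive semidefinite form. -/
theorem _root_.Matrix.PosDef.sq_dotProduct_mulVec_le {M : Matrix (Fin d) (Fin d) ℝ}
    (hM : M.PosDef) (x y : Vec d) :
    (x.ofLp ⬝ᵥ M *ᵥ y.ofLp) ^ 2 ≤ quad M x * quad M y := by
  by_cases hy : y = 0
  · simp [hy, quad]
  have hq := hM.quad_pos hy
  set s := (x.ofLp ⬝ᵥ M *ᵥ y.ofLp) / quad M y with hs
  have h := hM.posSemidef.quad_nonneg (x + (-s) • y)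
  rw [quad_add hM.isHermitian, quad_smul] at h
  simp only [WithLp.ofLp_smul, mulVec_smul, dotProduct_smul, smul_eq_mul] at h
  have hs' : x.ofLp ⬝ᵥ M *ᵥ y.ofLp = s * quad M y := by rw [hs]; field_simp
  rw [hs'] at h ⊢
  nlinarith

/-- The Cauchy-Schwarz inequality for dual norms. -/
theorem _root_.Matrix.PosDef.sq_inner_le {M : Matrix (Fin d) (Fin d) ℝ} (hM : M.PosDef)
    (x y : Vec d) : ⟪x, y⟫ ^ 2 ≤ quad M⁻¹ x * quad M y := by
  have h := hM.inv.sq_dotProduct_mulVec_le x (WithLp.toLp 2 (M *ᵥ y.ofLp))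
  have e : M⁻¹ *ᵥ (M *ᵥ y.ofLp) = y.ofLp := by
    rw [mulVec_mulVec, nonsing_inv_mul _ ((isUnit_iff_isUnit_det _).1 hM.isUnit), one_mulVec]
  rw [e, ← inner_eq_dotProduct] at h
  refine h.trans_eq ?_
  congr 1
  rw [quad, e, dotProduct_comm, quad]

theorem _root_.Matrix.PosDef.abs_inner_le {M : Matrix (Fin d) (Fin d) ℝ} (hM : M.PosDef)
    (x y : Vec d) : |⟪x, y⟫| ≤ wnorm M⁻¹ x * wnorm M y := by
  rw [wnorm, wnorm, ← Real.sqrt_mul (hM.inv.posSemidef.quad_nonneg x)]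
  exact Real.abs_le_sqrt (hM.sq_inner_le x y)

theorem wnorm_nonneg (M : Matrix (Fin d) (Fin d) ℝ) (x : Vec d) : 0 ≤ wnorm M x :=
  Real.sqrt_nonneg _

theorem _root_.Matrix.PosSemidef.sq_wnorm {M : Matrix (Fin d) (Fin d) ℝ} (hM : M.PosSemidef)
    (x : Vec d) : wnorm M x ^ 2 = quad M x := Real.sq_sqrt (hM.quad_nonneg x)

theorem _root_.Matrix.PosDef.wnorm_add_le {M : Matrix (Fin d) (Fin d) ℝ} (hM : M.PosDef)
    (x y : Vec d) : wnorm M (x + y) ≤ wnorm M x + wnorm M y := by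
  have h : |x.ofLp ⬝ᵥ M *ᵥ y.ofLp| ≤ wnorm M x * wnorm M y := by
    rw [wnorm, wnorm, ← Real.sqrt_mul (hM.posSemidef.quad_nonneg x)]
    exact Real.abs_le_sqrt (hM.sq_dotProduct_mulVec_le x y)
  have hx := hM.posSemidef.sq_wnorm x
  have hy := hM.posSemidef.sq_wnorm y
  refine Real.sqrt_le_iff.2 ⟨add_nonneg (wnorm_nonneg _ _) (wnorm_nonneg _ _), ?_⟩
  rw [quad_add hM.isHermitian]
  nlinarith [le_abs_self (x.ofLp ⬝ᵥ M *ᵥ y.ofLp)]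

/-- Inversion is antitone on positive definite matrices. -/
theorem mul_quad_inv_le {M W : Matrix (Fin d) (Fin d) ℝ} (hM : M.PosDef) (hW : W.PosDef) {c : ℝ}
    (hc : 0 ≤ c) (h : ∀ u, c * quad W u ≤ quad M u) (b : Vec d) :
    c * quad M⁻¹ b ≤ quad W⁻¹ b := by
  -- `u = M⁻¹ b` is the equality case of dual Cauchy-Schwarz for `M`: both `⟪b, u⟫` and `uᵀ M u`
  -- equal `bᵀ M⁻¹ b`. Testing the hypothesis and the inequality for `W` at `u` suffices.
  set u : Vec d := WithLp.toLp 2 (M⁻¹ *ᵥ b.ofLp) with hu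
  have h1 : ⟪b, u⟫ = quad M⁻¹ b := by rw [inner_eq_dotProduct, quad]
  have h2 : quad M u = quad M⁻¹ b := by
    rw [quad, hu, hM.mulVec_inv_mulVec, dotProduct_comm, quad]
  have h3 := hW.sq_inner_le b u
  have h4 := h u
  rw [h1] at h3
  rw [h2] at h4
  have h5 := hM.inv.posSemidef.quad_nonneg b
  have h6 := hW.inv.posSemidef.quad_nonneg b
  rcases h5.eq_or_lt with h0 | h0
  · rw [← h0]; simpa using h6
  · have : (c * quad M⁻¹ b) * quad M⁻¹ b ≤ quad W⁻¹ b * quad M⁻¹ b := by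
      nlinarith [mul_le_mul_of_nonneg_left h4 h6, mul_le_mul_of_nonneg_left h3 hc]
    exact le_of_mul_le_mul_right this h0

/-- Whitening: with `M⁻¹ = Qᵀ Q`, a standard Gaussian `g` gives `Qᵀ g` with covariance `M⁻¹`, so the
mixture can be integrated coordinate by coordinate. -/
theorem exists_quad_inv_eq_sum_sq {M : Matrix (Fin d) (Fin d) ℝ} (hM : M.PosDef) :
    ∃ Q : Matrix (Fin d) (Fin d) ℝ,
      (∀ x : Vec d, quad M⁻¹ x = ∑ i, (Q *ᵥ x.ofLp) i ^ 2) ∧ Q * M * Qᵀ = 1 := by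
  obtain ⟨Q, hQ⟩ : ∃ Q : Matrix (Fin d) (Fin d) ℝ, M⁻¹ = Qᵀ * Q := by
    open scoped MatrixOrder in
    obtain ⟨Q, hQ⟩ := CStarAlgebra.nonneg_iff_eq_star_mul_self.1 hM.inv.posSemidef.nonneg
    exact ⟨Q, by simpa [star_eq_conjTranspose, conjTranspose_eq_transpose_of_trivial] using hQ⟩
  have hd := (isUnit_iff_isUnit_det _).1 hM.isUnit
  refine ⟨Q, fun x => ?_, ?_⟩
  · rw [quad, hQ, ← mulVec_mulVec, dotProduct_mulVec, vecMul_transpose]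
    simp [dotProduct, sq]
  · have h1 : (M * Qᵀ) * Q = 1 := by rw [Matrix.mul_assoc, ← hQ, mul_nonsing_inv _ hd]
    rw [Matrix.mul_assoc]
    exact mul_eq_one_comm.1 h1

end LinearAlgebra

/-! ### Optimal designs -/

section Design

open Matrix

variable {d : ℕ} {B : Finset (Vec d)}

theorem quad_infoMatrix (π : B → ℝ) (x : Vec d) :
    quad (infoMatrix π) x = ∑ b : B, π b * ⟪x, (b : Vec d)⟫ ^ 2 := by
  simp_rw [infoMatrix, quad_sum_matrix, quad_smul_matrix, quad_outer]

theorem posSemidef_infoMatrix {π : B → ℝ} (hπ : π ∈ stdSimplex ℝ B) :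
    (infoMatrix π).PosSemidef :=
  posSemidef_sum _ fun b _ => (posSemidef_outer _).smul (hπ.1 b)

theorem eq_zero_of_inner_eq_zero {S : Set (Vec d)} (hS : Submodule.span ℝ S = ⊤) {x : Vec d}
    (hx : ∀ b ∈ S, ⟪x, b⟫ = 0) : x = 0 := by
  have : ∀ y ∈ Submodule.span ℝ S, ⟪x, y⟫ = 0 := fun y hy => by
    induction hy using Submodule.span_induction with
    | mem y hy => exact hx y hy
    | zero => exact inner_zero_right _
    | add y z _ _ h1 h2 => rw [inner_add_right, h1, h2, add_zero]
    | smul c y _ h => rw [real_inner_smul_right, h, mul_zero]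
  exact inner_self_eq_zero.1 (this x (hS ▸ Submodule.mem_top))

theorem posDef_infoMatrix_of_pos (hspan : Submodule.span ℝ (B : Set (Vec d)) = ⊤) {π : B → ℝ}
    (hπ : π ∈ stdSimplex ℝ B) (hpos : ∀ b, 0 < π b) : (infoMatrix π).PosDef := by
  refine (posSemidef_infoMatrix hπ).posDef_of_quad_ne_zero fun x hx => ?_
  rw [quad_infoMatrix, Finset.sum_eq_zero_iff_of_nonneg
    fun b _ => mul_nonneg (hπ.1 b) (sq_nonneg _)] at hx
  refine eq_zero_of_inner_eq_zero hspan fun b hb => ?_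
  simpa [(hpos ⟨b, hb⟩).ne'] using hx ⟨b, hb⟩ (Finset.mem_univ _)

/-- The matrix determinant lemma; it converts maximality of the determinant into a bound on `bᵀ M⁻¹
b`. -/
theorem det_add_smul_outer {M : Matrix (Fin d) (Fin d) ℝ} (hM : IsUnit M.det) (c : ℝ)
    (b : Vec d) : (M + c • outer b).det = M.det * (1 + c * quad M⁻¹ b) := by
  have h := det_add_replicateCol_mul_replicateRow (ι := Unit) hM (c • b.ofLp) b.ofLp
  rw [← vecMulVec_eq, smul_vecMulVec] at h
  rw [outer, h, det_unique (_ + _)]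
  congr 1
  rw [Matrix.mul_assoc, ← replicateCol_mulVec, Matrix.add_apply, one_apply_eq,
    replicateRow_mul_replicateCol_apply, mulVec_smul, dotProduct_smul, smul_eq_mul, quad]

theorem infoMatrix_single [DecidableEq B] (b : B) :
    infoMatrix (Pi.single b (1 : ℝ)) = outer (b : Vec d) := by
  rw [infoMatrix, Finset.sum_eq_single b]
  · simp
  · intro c _ hc; simp [hc]
  · simp

theorem infoMatrix_add (π ρ : B → ℝ) : infoMatrix (π + ρ) = infoMatrix π + infoMatrix ρ := by
  simp [infoMatrix, add_smul, Finset.sum_add_distrib]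

theorem infoMatrix_smul (c : ℝ) (π : B → ℝ) : infoMatrix (c • π) = c • infoMatrix π := by
  simp [infoMatrix, mul_smul, Finset.smul_sum]

theorem continuous_det_infoMatrix : Continuous fun π : B → ℝ => (infoMatrix π).det := by
  refine Continuous.matrix_det ?_
  unfold infoMatrix
  fun_prop

/-- If `(1 - s) ^ d (1 + s / (1 - s) q) ≤ 1` for all `s ∈ (0, 1)`, then `q ≤ d`. -/
theorem le_natCast_of_pow_mul_le {q : ℝ} (hd : 0 < d)
    (h : ∀ s : ℝ, 0 < s → s < 1 → (1 - s) ^ d * (1 + s / (1 - s) * q) ≤ 1) : q ≤ d := by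
  obtain ⟨n, rfl⟩ : ∃ n, d = n + 1 := ⟨d - 1, by omega⟩
  by_contra! hq
  push_cast at hq
  have hn : (0 : ℝ) ≤ n := n.cast_nonneg
  -- Bernoulli's inequality reduces the hypothesis to `q - (n + 1) ≤ n (q - 1) s`. With `s = (q - (n
  -- + 1)) / D` this says `D ≤ n (q - 1)`, which this `D` violates; it also exceeds `q - (n + 1)`,
  -- so that `s < 1`.
  set D : ℝ := (n + 1) * q + 1 with hD
  have hDpos : 1 < D := by nlinarith
  have hDpos' : 0 < D := by linarith
  set s : ℝ := (q - (n + 1)) / D with hs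
  have hs0 : 0 < s := div_pos (by linarith) hDpos'
  have hsD : s * D = q - (n + 1) := by rw [hs]; field_simp
  have hs1 : s < 1 := by rw [hs, div_lt_one hDpos']; nlinarith
  have h1 := h s hs0 hs1
  have h1s : (0 : ℝ) < 1 - s := by linarith
  have h2 : (1 - s) ^ (n + 1) * (1 + s / (1 - s) * q) = (1 - s) ^ n * (1 - s + s * q) := by
    rw [pow_succ]; field_simp
  rw [h2] at h1
  have h3 : 1 - n * s ≤ (1 - s) ^ n := by
    have := one_add_mul_le_pow (a := -s) (by linarith) n
    rw [← sub_eq_add_neg] at this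
    linarith
  have h4 : (1 - n * s) * (1 - s + s * q) ≤ 1 :=
    (mul_le_mul_of_nonneg_right h3 (by nlinarith)).trans h1
  have h5 : s * ((q - (n + 1)) - n * (q - 1) * s) ≤ 0 := by nlinarith
  have h6 : (q - (n + 1)) - n * (q - 1) * s ≤ 0 := by
    by_contra! h7
    exact absurd h5 (not_le.2 (mul_pos hs0 h7))
  nlinarith

/-- The Kiefer-Wolfowitz theorem: some design `π` satisfies `g(π) ≤ d`. -/
theorem exists_gValue_le (hd : 0 < d) (hspan : Submodule.span ℝ (B : Set (Vec d)) = ⊤) :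
    ∃ π ∈ stdSimplex ℝ B, gValue π ≤ ENNReal.ofReal d := by
  classical
  have hne : Nonempty B := by
    by_contra hB
    rw [not_nonempty_iff, Finset.isEmpty_coe_sort] at hB
    have h0 : (EuclideanSpace.single ⟨0, hd⟩ (1 : ℝ) : Vec d) = 0 :=
      eq_zero_of_inner_eq_zero hspan (by simp [hB])
    simpa using congrArg norm h0
  have hu : (fun _ : B => (Fintype.card B : ℝ)⁻¹) ∈ stdSimplex ℝ B :=
    ⟨fun _ => by positivity, by
      rw [Finset.sum_const, Finset.card_univ, nsmul_eq_mul, mul_inv_cancel₀]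
      exact Nat.cast_ne_zero.2 Fintype.card_ne_zero⟩
  -- A D-optimal design: `π` maximizes `det V(π)`. Moving mass `s` from `π` to a point `b` cannot
  -- increase the determinant, which is the input of `le_natCast_of_pow_mul_le`. The uniform design
  -- shows that the maximum is positive.
  obtain ⟨π, hπ, hmax⟩ := (isCompact_stdSimplex ℝ B).exists_isMaxOn ⟨_, hu⟩
    continuous_det_infoMatrix.continuousOn
  have hdet : 0 < (infoMatrix π).det :=
    (posDef_infoMatrix_of_pos hspan hu fun _ => by
      have := Fintype.card_pos (α := B); positivity).det_pos.trans_le (hmax hu)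
  have hunit : IsUnit (infoMatrix π).det := hdet.ne'.isUnit
  refine ⟨π, hπ, ?_⟩
  rw [gValue, if_pos hunit]
  refine iSup_le fun b => ENNReal.ofReal_le_ofReal (le_natCast_of_pow_mul_le hd fun s hs0 hs1 => ?_)
  have h1s : 0 < 1 - s := by linarith
  have hmem : (1 - s) • π + s • Pi.single b (1 : ℝ) ∈ stdSimplex ℝ B :=
    convex_stdSimplex ℝ B hπ (single_mem_stdSimplex ℝ b) h1s.le hs0.le (by ring)
  have h := hmax hmem
  have e : infoMatrix ((1 - s) • π + s • Pi.single b (1 : ℝ)) =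
      (1 - s) • (infoMatrix π + (s / (1 - s)) • outer (b : Vec d)) := by
    rw [infoMatrix_add, infoMatrix_smul, infoMatrix_smul, infoMatrix_single, smul_add, smul_smul,
      mul_div_cancel₀ _ h1s.ne']
  simp only [Set.mem_ofPred_eq] at h
  rw [e, det_smul, det_add_smul_outer hunit, Fintype.card_fin] at h
  have : (infoMatrix π).det * ((1 - s) ^ d * (1 + s / (1 - s) * quad (infoMatrix π)⁻¹ b)) ≤
      (infoMatrix π).det * 1 := by linarith
  exact le_of_mul_le_mul_left this hdet

/-- The optimal design does at least as well as the Kiefer-Wolfowitz one. Nonsingularity of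
`V(πhat)` comes for free, as `g` would otherwise be `⊤`. -/
theorem IsApproxDesign.posDef_and_quad_le (hd : 0 < d)
    (hspan : Submodule.span ℝ (B : Set (Vec d)) = ⊤) {ε : ℝ} (hε : 0 < ε) {πstar πhat : B → ℝ}
    (hstar : IsOptimalDesign πstar) (hhat : IsApproxDesign ε πstar πhat) :
    (infoMatrix πhat).PosDef ∧ ∀ b ∈ B, quad (infoMatrix πhat)⁻¹ b ≤ (1 + ε) * d := by
  obtain ⟨π, hπ, hπd⟩ := exists_gValue_le hd hspan
  have hg : gValue πhat ≤ ENNReal.ofReal ((1 + ε) * d) := by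
    rw [ENNReal.ofReal_mul (by linarith)]
    exact hhat.2.trans (mul_le_mul_right ((hstar.2 π hπ).trans hπd) _)
  have hunit : IsUnit (infoMatrix πhat).det := by
    by_contra hu
    rw [gValue, if_neg hu] at hg
    exact absurd hg (by simp)
  have hpsd := posSemidef_infoMatrix hhat.1
  refine ⟨(hpsd.posDef_iff_isUnit).2 ((isUnit_iff_isUnit_det _).2 hunit), fun b hb => ?_⟩
  rw [gValue, if_pos hunit] at hg
  exact (ENNReal.ofReal_le_ofReal_iff (by positivity)).1
    ((le_iSup (fun b : B => ENNReal.ofReal (quad (infoMatrix πhat)⁻¹ (b : Vec d))) ⟨b, hb⟩).trans hg)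

end Design

/-! ### Concentration of the score -/

section Concentration

/-- Hoeffding's lemma for a centered Bernoulli variable. -/
theorem bernoulli_mgf_le {p : ℝ} (hp0 : 0 ≤ p) (hp1 : p ≤ 1) (c : ℝ) :
    Real.exp (-(c * p)) * (1 + (Real.exp c - 1) * p) ≤ Real.exp (c ^ 2 / 8) := by
  set μ : Measure ℝ := ENNReal.ofReal p • Measure.dirac 1 + ENNReal.ofReal (1 - p) • Measure.dirac 0
    with hμ
  have hprob : IsProbabilityMeasure μ := ⟨by
    simp [hμ, ← ENNReal.ofReal_add hp0 (sub_nonneg.2 hp1)]⟩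
  have hint : ∀ f : ℝ → ℝ, ∫ x, f x ∂μ = p * f 1 + (1 - p) * f 0 := fun f => by
    have hi : ∀ a : ℝ, Integrable f (Measure.dirac a) := fun a =>
      integrable_dirac (by simp)
    rw [hμ, integral_add_measure ((hi 1).smul_measure (by simp)) ((hi 0).smul_measure (by simp)),
      integral_smul_measure, integral_smul_measure, integral_dirac, integral_dirac,
      ENNReal.toReal_ofReal hp0, ENNReal.toReal_ofReal (sub_nonneg.2 hp1)]
    simp
  have hmem : ∀ᵐ x ∂μ, (id x : ℝ) ∈ Set.Icc (0 : ℝ) 1 := by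
    rw [hμ, ae_add_measure_iff]
    constructor <;> refine Measure.ae_smul_measure ?_ _ <;> simp [ae_dirac_eq]
  have h := (hasSubgaussianMGF_of_mem_Icc (μ := μ) aemeasurable_id hmem).mgf_le c
  simp only [mgf, hint, id] at h
  have e1 : Real.exp (c * (1 - (p * 1 + (1 - p) * 0))) = Real.exp (-(c * p)) * Real.exp c := by
    rw [← Real.exp_add]; ring_nf
  have e2 : Real.exp (c * (0 - (p * 1 + (1 - p) * 0))) = Real.exp (-(c * p)) := by ring_nf
  rw [e1, e2] at h
  convert h using 1
  · ring
  · congr 1; norm_num; ring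

variable {Ω : Type*} [mΩ : MeasurableSpace Ω] {P : Measure Ω} [IsProbabilityMeasure P]

/-- Tower property: `f` is known given `m`, so the indicator may be replaced by its constant
conditional probability. -/
theorem integral_mul_indicator_of_condProb_eq {m : MeasurableSpace Ω} (hm : m ≤ mΩ) {f : Ω → ℝ}
    (hf : StronglyMeasurable[m] f) (hfi : Integrable f P) {s : Set Ω} (hs : MeasurableSet[mΩ] s)
    {p : ℝ} (hp : P⟦s | m⟧ =ᵐ[P] fun _ => p) :
    ∫ ω, f ω * s.indicator (fun _ => (1 : ℝ)) ω ∂P = p * ∫ ω, f ω ∂P := by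
  have hI : Integrable (s.indicator fun _ => (1 : ℝ)) P := (integrable_const 1).indicator hs
  have hfI : Integrable (f * s.indicator fun _ => (1 : ℝ)) P := by
    refine (hfi.indicator hs).congr (ae_of_all _ fun ω => ?_)
    by_cases h : ω ∈ s <;> simp [h]
  have h := condExp_mul_of_stronglyMeasurable_left (μ := P) hf hfI hI
  calc ∫ ω, f ω * s.indicator (fun _ => (1 : ℝ)) ω ∂P
      = ∫ ω, (P[f * s.indicator (fun _ => (1 : ℝ)) | m]) ω ∂P := (integral_condExp hm).symm
    _ = ∫ ω, f ω * p ∂P := integral_congr_ae (h.trans (by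
        filter_upwards [hp] with ω hω
        simp [hω]))
    _ = p * ∫ ω, f ω ∂P := by rw [integral_mul_const, mul_comm]

variable {ℱ : Filtration ℕ mΩ} {d M : ℕ} {θ : Vec d} {al am : Fin M → Vec d} {Y : Fin M → Ω → ℝ}

theorem IsPreferenceFeedback.integrable_exp (hY : IsPreferenceFeedback P ℱ θ al am Y)
    (c : Fin M → ℝ) (p : Fin M → ℝ) (s : Finset (Fin M)) :
    Integrable (fun ω => Real.exp (∑ t ∈ s, c t * (Y t ω - p t))) P := by
  have hmeas : Measurable fun ω => Real.exp (∑ t ∈ s, c t * (Y t ω - p t)) :=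
    (Finset.measurable_sum _ fun t _ =>
      (((hY.measurable t).mono (ℱ.le _) le_rfl).sub_const _).const_mul _).exp
  refine Integrable.of_bound hmeas.aestronglyMeasurable
    (Real.exp (∑ t ∈ s, |c t| * (1 + |p t|))) (ae_of_all _ fun ω => ?_)
  rw [Real.norm_eq_abs, Real.abs_exp, Real.exp_le_exp]
  refine Finset.sum_le_sum fun t _ => (le_abs_self _).trans ?_
  rw [abs_mul]
  refine mul_le_mul_of_nonneg_left ((abs_sub _ _).trans ?_) (abs_nonneg _)
  rcases hY.zero_or_one t ω with h | h <;> simp [h]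

/-- Conditionally on the past, round `t` multiplies the exponential moment by at most `exp(c_t² /
8)`; the rounds are peeled off from the last one. -/
theorem IsPreferenceFeedback.integral_exp_le (hY : IsPreferenceFeedback P ℱ θ al am Y)
    (c : Fin M → ℝ) :
    ∫ ω, Real.exp (∑ t, c t * (Y t ω - Real.sigmoid ⟪θ, al t - am t⟫)) ∂P ≤
      Real.exp ((∑ t, c t ^ 2) / 8) := by
  set p : Fin M → ℝ := fun t => Real.sigmoid ⟪θ, al t - am t⟫ with hp
  have key : ∀ k ≤ M, ∫ ω, Real.exp (∑ t with t.val < k, c t * (Y t ω - p t)) ∂P ≤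
      Real.exp ((∑ t : Fin M with t.val < k, c t ^ 2) / 8) := by
    intro k
    induction k with
    | zero => intro _; simp
    | succ k ih =>
      intro hk
      set t₀ : Fin M := ⟨k, hk⟩ with ht₀
      have hins : (Finset.univ.filter fun t : Fin M => t.val < k + 1) =
          insert t₀ (Finset.univ.filter fun t : Fin M => t.val < k) := by
        ext t
        simp [ht₀, Fin.ext_iff]
        omega
      have hnot : t₀ ∉ Finset.univ.filter fun t : Fin M => t.val < k := by simp [ht₀]
      rw [hins, Finset.sum_insert hnot]
      simp only [Finset.sum_insert hnot]
      set f : Ω → ℝ := fun ω => Real.exp (∑ t with t.val < k, c t * (Y t ω - p t)) with hf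
      have hfm : Measurable[ℱ k] f := by
        refine Measurable.exp (Finset.measurable_sum _ fun t ht => ?_)
        -- Label `t` is revealed in `ℱ (t + 1)`, so the labels before round `k` are all `ℱ
        -- k`-measurable.
        have ht' : t.val + 1 ≤ k := by simpa using ht
        exact (((hY.measurable t).mono (ℱ.mono ht') le_rfl).sub_const _).const_mul _
      have hfi : Integrable f P := hY.integrable_exp c p _
      set s := Y t₀ ⁻¹' {1} with hs
      have hsm : MeasurableSet s :=
        ((hY.measurable t₀).mono (ℱ.le _) le_rfl) (measurableSet_singleton 1)
      have hfI : Integrable (fun ω => f ω * s.indicator (fun _ => (1 : ℝ)) ω) P := by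
        refine (hfi.indicator hsm).congr (ae_of_all _ fun ω => ?_)
        by_cases h : ω ∈ s <;> simp [h]
      -- A binary label makes the new exponential factor affine in the indicator of `Y = 1`, so only
      -- the conditional probability of that event is needed.
      have hpt : ∀ ω, Real.exp (c t₀ * (Y t₀ ω - p t₀) +
          ∑ t with t.val < k, c t * (Y t ω - p t)) = Real.exp (-(c t₀ * p t₀)) *
            (f ω + (Real.exp (c t₀) - 1) * (f ω * s.indicator (fun _ => (1 : ℝ)) ω)) := by
        intro ω
        rw [Real.exp_add]
        rcases hY.zero_or_one t₀ ω with h | h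
        · have : ω ∉ s := by simp [hs, h]
          simp [this, h, hf]
        · have : ω ∈ s := by simp [hs, h]
          have e : Real.exp (c t₀ * (1 - p t₀)) = Real.exp (-(c t₀ * p t₀)) * Real.exp (c t₀) := by
            rw [← Real.exp_add]; ring_nf
          rw [h, e]
          simp only [this, Set.indicator_of_mem, hf]
          ring
      simp_rw [hpt]
      rw [integral_const_mul, integral_add hfi (hfI.const_mul _), integral_const_mul,
        integral_mul_indicator_of_condProb_eq (ℱ.le k) hfm.stronglyMeasurable hfi hsm
          (hY.cond_prob t₀)]
      have hb := bernoulli_mgf_le (Real.sigmoid_nonneg ⟪θ, al t₀ - am t₀⟫)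
        (Real.sigmoid_le_one _) (c t₀)
      have hf0 : 0 ≤ ∫ ω, f ω ∂P := integral_nonneg fun ω => (Real.exp_pos _).le
      calc _ = (Real.exp (-(c t₀ * p t₀)) * (1 + (Real.exp (c t₀) - 1) * p t₀)) *
            ∫ ω, f ω ∂P := by simp only [hp]; ring
        _ ≤ Real.exp (c t₀ ^ 2 / 8) *
            Real.exp ((∑ t : Fin M with t.val < k, c t ^ 2) / 8) :=
          mul_le_mul hb (ih (by omega)) hf0 (Real.exp_pos _).le
        _ = _ := by rw [← Real.exp_add]; ring_nf
  have h := key M le_rfl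
  simpa using h

/-- The centered score `∑ₜ (Yₜ - σ(⟪θ, Bₜ⟫)) Bₜ`. -/
noncomputable def score (θ : Vec d) (al am : Fin M → Vec d) (y : Fin M → ℝ) : Vec d :=
  ∑ t, (y t - Real.sigmoid ⟪θ, al t - am t⟫) • (al t - am t)

/-- The Gaussian exponent becomes `-(1/2 - 1/8) g² = -(3/8) g²`, whence the factor `(1 -
1/4)^{-1/2}`. -/
theorem lintegral_exp_sq_gaussianReal :
    ∫⁻ g, ENNReal.ofReal (Real.exp (g ^ 2 / 8)) ∂gaussianReal 0 1 =
      ENNReal.ofReal (Real.sqrt (4 / 3)) := by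
  rw [gaussianReal_of_var_ne_zero 0 one_ne_zero, lintegral_withDensity_eq_lintegral_mul _
    (measurable_gaussianPDF 0 1) (by fun_prop)]
  have e : ∀ g : ℝ, (gaussianPDF 0 1 * fun g => ENNReal.ofReal (Real.exp (g ^ 2 / 8))) g =
      ENNReal.ofReal ((√(2 * Real.pi))⁻¹ * Real.exp (-(3 / 8) * g ^ 2)) := fun g => by
    rw [Pi.mul_apply, gaussianPDF, ← ENNReal.ofReal_mul (gaussianPDFReal_nonneg _ _ _),
      gaussianPDFReal, mul_assoc, ← Real.exp_add]
    congr 3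
    · simp
    · simp; ring
  simp_rw [e]
  rw [← ofReal_integral_eq_lintegral_ofReal ((integrable_exp_neg_mul_sq (by norm_num)).const_mul _)
    (ae_of_all _ fun g => by positivity), integral_const_mul, integral_gaussian]
  congr 1
  rw [← Real.sqrt_inv, ← Real.sqrt_mul (by positivity)]
  congr 1
  field_simp
  norm_num

theorem lintegral_exp_mul_gaussianReal (x : ℝ) :
    ∫⁻ g, ENNReal.ofReal (Real.exp (x * g)) ∂gaussianReal 0 1 =
      ENNReal.ofReal (Real.exp (x ^ 2 / 2)) := by
  have h := congrFun (mgf_fun_id_gaussianReal (μ := 0) (v := 1)) x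
  simp only [mgf] at h
  rw [← ofReal_integral_eq_lintegral_ofReal (integrable_exp_mul_gaussianReal x)
    (ae_of_all _ fun g => by positivity), h]
  simp

theorem lintegral_pi_prod {ι : Type*} [Fintype ι] (μ : Measure ℝ) [IsProbabilityMeasure μ]
    {f : ι → ℝ → ℝ≥0∞} (hf : ∀ i, Measurable (f i)) :
    ∫⁻ g, ∏ i, f i (g i) ∂Measure.pi (fun _ : ι => μ) = ∏ i, ∫⁻ x, f i x ∂μ := by
  have hind := iIndepFun_pi (μ := fun _ : ι => μ) (X := f) fun i => (hf i).aemeasurable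
  rw [lintegral_prod_eq_prod_lintegral_of_indepFun Finset.univ _ hind
    fun i => (hf i).comp (measurable_pi_apply i)]
  exact Finset.prod_congr rfl fun i _ =>
    (measurePreserving_eval (fun _ : ι => μ) i).lintegral_comp (hf i)

/-- Linearizes the square in the exponent: what remains is linear in `x`, and so in the labels when
`x = Q S`. -/
theorem ofReal_exp_sum_sq_eq_lintegral (x : Fin d → ℝ) :
    ENNReal.ofReal (Real.exp ((∑ i, x i ^ 2) / 2)) =
      ∫⁻ g, ENNReal.ofReal (Real.exp (∑ i, x i * g i))
        ∂Measure.pi fun _ : Fin d => gaussianReal 0 1 := by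
  simp_rw [Real.exp_sum, ENNReal.ofReal_prod_of_nonneg fun _ _ => (Real.exp_pos _).le]
  rw [lintegral_pi_prod (f := fun i y => ENNReal.ofReal (Real.exp (x i * y))) _
    fun i => by fun_prop]
  simp_rw [lintegral_exp_mul_gaussianReal]
  rw [← ENNReal.ofReal_prod_of_nonneg fun _ _ => (Real.exp_pos _).le, ← Real.exp_sum,
    Finset.sum_div]

theorem lintegral_exp_sum_sq_gaussian :
    ∫⁻ g, ENNReal.ofReal (Real.exp ((∑ i, g i ^ 2) / 8))
        ∂Measure.pi (fun _ : Fin d => gaussianReal 0 1) =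
      ENNReal.ofReal (Real.sqrt (4 / 3) ^ d) := by
  simp_rw [Finset.sum_div, Real.exp_sum,
    ENNReal.ofReal_prod_of_nonneg fun _ _ => (Real.exp_pos _).le]
  rw [lintegral_pi_prod (f := fun _ y => ENNReal.ofReal (Real.exp (y ^ 2 / 8))) _
    fun i => by fun_prop]
  rw [lintegral_exp_sq_gaussianReal, Finset.prod_const, Finset.card_univ, Fintype.card_fin,
    ENNReal.ofReal_pow (Real.sqrt_nonneg _)]

omit [IsProbabilityMeasure P] in
theorem IsPreferenceFeedback.measurable_score (hY : IsPreferenceFeedback P ℱ θ al am Y) :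
    Measurable fun ω => score θ al am fun t => Y t ω :=
  Finset.measurable_sum _ fun t _ =>
    (((hY.measurable t).mono (ℱ.le _) le_rfl).sub_const _).smul_const _

theorem continuous_quad (M : Matrix (Fin d) (Fin d) ℝ) : Continuous (quad M) := by
  unfold quad
  fun_prop

open Matrix in
/-- The exponential moment of the squared dual norm of the score, by the method of mixtures. -/
theorem IsPreferenceFeedback.lintegral_exp_quad_score_le
    (hY : IsPreferenceFeedback P ℱ θ al am Y) {V : Matrix (Fin d) (Fin d) ℝ} (hV : V.PosDef)
    (hVB : ∀ u, ∑ t, ⟪u, al t - am t⟫ ^ 2 ≤ quad V u) :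
    ∫⁻ ω, ENNReal.ofReal (Real.exp (quad V⁻¹ (score θ al am fun t => Y t ω) / 2)) ∂P ≤
      ENNReal.ofReal (Real.sqrt (4 / 3) ^ d) := by
  obtain ⟨Q, hQ, hQV⟩ := exists_quad_inv_eq_sum_sq hV
  set S : Ω → Vec d := fun ω => score θ al am fun t => Y t ω with hS
  have hSm : Measurable S := hY.measurable_score
  let v : (Fin d → ℝ) → Vec d := fun g => WithLp.toLp 2 (Qᵀ *ᵥ g)
  have hv : ∀ ω g, ∑ i, (Q *ᵥ (S ω).ofLp) i * g i =
      ∑ t, ⟪v g, al t - am t⟫ * (Y t ω - Real.sigmoid ⟪θ, al t - am t⟫) := fun ω g => by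
    have h1 : ∑ i, (Q *ᵥ (S ω).ofLp) i * g i = ⟪v g, S ω⟫ := by
      have : (v g).ofLp = Qᵀ *ᵥ g := rfl
      rw [inner_eq_dotProduct, this, mulVec_transpose, ← dotProduct_mulVec, dotProduct_comm]
      rfl
    rw [h1, hS]
    simp only [score, inner_sum, real_inner_smul_right]
    exact Finset.sum_congr rfl fun t _ => mul_comm _ _
  have hvV : ∀ g, quad V (v g) = ∑ i, g i ^ 2 := fun g => by
    have : quad V (v g) = g ⬝ᵥ (Q * V * Qᵀ) *ᵥ g := by
      simp only [quad, v, mulVec_transpose]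
      rw [← dotProduct_mulVec, ← mulVec_transpose, mulVec_mulVec, mulVec_mulVec, Matrix.mul_assoc]
    rw [this, hQV, one_mulVec]
    simp [dotProduct, sq]
  have hmeas : Measurable (Function.uncurry fun (ω : Ω) (g : Fin d → ℝ) =>
      ENNReal.ofReal (Real.exp (∑ i, (Q *ᵥ (S ω).ofLp) i * g i))) := by
    have h1 : Continuous fun q : Vec d × (Fin d → ℝ) => ∑ i, (Q *ᵥ q.1.ofLp) i * q.2 i := by
      simp only [mulVec, dotProduct]
      fun_prop
    exact ((h1.measurable.comp ((hSm.comp measurable_fst).prodMk measurable_snd)).exp).ennreal_ofReal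
  simp_rw [hQ, ofReal_exp_sum_sq_eq_lintegral]
  -- Tonelli. For fixed `g` the exponent is a sum over labels with coefficients `⟪Qᵀ g, B_t⟫`, whose
  -- squares sum to at most `‖g‖²`; Hoeffding bounds the inner integral by `exp(‖g‖² / 8)`.
  rw [lintegral_lintegral_swap hmeas.aemeasurable]
  rw [← lintegral_exp_sum_sq_gaussian]
  refine lintegral_mono fun g => ?_
  simp_rw [hv]
  rw [← ofReal_integral_eq_lintegral_ofReal (hY.integrable_exp _ _ _)
    (ae_of_all _ fun ω => (Real.exp_pos _).le)]
  refine ENNReal.ofReal_le_ofReal ((hY.integral_exp_le _).trans (Real.exp_le_exp.2 ?_))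
  have := hVB (v g)
  rw [hvV] at this
  linarith

/-- Markov's inequality for `exp(‖S‖²_{V⁻¹} / 2)` at level `(4/3)^{d/2} / δ`. -/
theorem IsPreferenceFeedback.le_measure_quad_score_le
    (hY : IsPreferenceFeedback P ℱ θ al am Y) {V : Matrix (Fin d) (Fin d) ℝ} (hV : V.PosDef)
    (hVB : ∀ u, ∑ t, ⟪u, al t - am t⟫ ^ 2 ≤ quad V u) {δ : ℝ} (hδ : 0 < δ) :
    ENNReal.ofReal (1 - δ) ≤ P {ω | quad V⁻¹ (score θ al am fun t => Y t ω) ≤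
      2 * Real.log (1 / δ) + d * Real.log (4 / 3)} := by
  set q : Ω → ℝ := fun ω => quad V⁻¹ (score θ al am fun t => Y t ω) with hq
  have hqm : Measurable q := (continuous_quad _).measurable.comp hY.measurable_score
  set C : ℝ := Real.sqrt (4 / 3) ^ d with hC
  have hCpos : 0 < C := by positivity
  have hlog : Real.log (C / δ) = (2 * Real.log (1 / δ) + d * Real.log (4 / 3)) / 2 := by
    rw [Real.log_div hCpos.ne' hδ.ne', hC, Real.log_pow, Real.log_sqrt (by norm_num), one_div,
      Real.log_inv]
    ring
  have hmarkov := meas_ge_le_lintegral_div (μ := P)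
    (f := fun ω => ENNReal.ofReal (Real.exp (q ω / 2)))
    (hqm.div_const 2).exp.ennreal_ofReal.aemeasurable
    (ε := ENNReal.ofReal (C / δ)) (by simpa using div_pos hCpos hδ) (by simp)
  have hbad : P {ω | ENNReal.ofReal (C / δ) ≤ ENNReal.ofReal (Real.exp (q ω / 2))} ≤
      ENNReal.ofReal δ := by
    refine hmarkov.trans ((ENNReal.div_le_div_right (hY.lintegral_exp_quad_score_le hV hVB) _).trans ?_)
    rw [← ENNReal.ofReal_div_of_pos (by positivity)]
    refine ENNReal.ofReal_le_ofReal (le_of_eq ?_)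
    field_simp
    rfl
  have hms : MeasurableSet {ω | q ω ≤ 2 * Real.log (1 / δ) + d * Real.log (4 / 3)} :=
    measurableSet_le hqm measurable_const
  have hcompl : P {ω | q ω ≤ 2 * Real.log (1 / δ) + d * Real.log (4 / 3)}ᶜ ≤ ENNReal.ofReal δ := by
    refine (measure_mono fun ω hω => ?_).trans hbad
    simp only [Set.mem_compl_iff, Set.mem_ofPred_eq, not_le] at hω ⊢
    refine ENNReal.ofReal_le_ofReal ?_
    rw [← Real.exp_log (div_pos hCpos hδ), Real.exp_le_exp, hlog]
    linarith
  rw [prob_compl_eq_one_sub hms, tsub_le_iff_right] at hcompl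
  rw [ENNReal.ofReal_sub _ hδ.le, ENNReal.ofReal_one, tsub_le_iff_left]
  exact hcompl

end Concentration

/-! ### The sigmoid on `[-2, 2]` -/

/-- The product is `1 / (2 + 2 cosh z)`, smallest at `|z| = 2`; `cosh 2 ≤ 3.765` makes the
denominator at most `9.53`. -/
theorem le_sigmoid_mul_one_sub {z : ℝ} (hz : |z| ≤ 2) :
    100 / 953 ≤ Real.sigmoid z * (1 - Real.sigmoid z) := by
  have hcosh : Real.cosh z ≤ Real.cosh 2 := Real.cosh_le_cosh.2 (by simpa using hz)
  have hc2 : Real.cosh 2 ≤ 3.765 := by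
    have h1 := Real.exp_one_lt_d9
    have h2 := Real.exp_one_gt_d9
    have e1 : Real.exp 2 = Real.exp 1 * Real.exp 1 := by rw [← Real.exp_add]; norm_num
    have e2 : Real.exp (-2) * Real.exp 2 = 1 := by rw [← Real.exp_add]; norm_num
    have h3 : Real.exp 2 ≤ 7.3892 := by rw [e1]; nlinarith
    have h4 : 7.389 ≤ Real.exp 2 := by rw [e1]; nlinarith
    have h5 : Real.exp (-2) ≤ 0.1354 := by nlinarith [Real.exp_pos (-2)]
    rw [Real.cosh_eq]
    linarith
  rw [← Real.sigmoid_neg, Real.sigmoid_def, Real.sigmoid_def, neg_neg, ← mul_inv]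
  have e : (1 + Real.exp (-z)) * (1 + Real.exp z) = 2 + 2 * Real.cosh z := by
    have : Real.exp (-z) * Real.exp z = 1 := by rw [← Real.exp_add]; simp
    rw [Real.cosh_eq]
    linear_combination this
  rw [e, ← one_div, div_le_div_iff₀ (by norm_num) (by linarith [Real.cosh_pos z])]
  linarith

theorem mul_sq_sub_le_sigmoid_sub_mul {x y : ℝ} (hx : |x| ≤ 2) (hy : |y| ≤ 2) :
    100 / 953 * (x - y) ^ 2 ≤ (Real.sigmoid x - Real.sigmoid y) * (x - y) := by
  wlog hxy : y ≤ x generalizing x y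
  · have := this hy hx (by linarith)
    linarith
  have h := (convex_Icc (-2 : ℝ) 2).mul_sub_le_image_sub_of_le_deriv (f := Real.sigmoid)
    continuous_sigmoid.continuousOn differentiable_sigmoid.differentiableOn
    (C := 100 / 953) (fun z hz => by
      rw [Real.deriv_sigmoid]
      exact le_sigmoid_mul_one_sub (abs_le.2 (Set.mem_Icc.1 (interior_subset hz))))
    y (abs_le.1 hy) x (abs_le.1 hx) hxy
  nlinarith

theorem hasDerivAt_log_sigmoid (x : ℝ) :
    HasDerivAt (fun z => Real.log (Real.sigmoid z)) (1 - Real.sigmoid x) x := by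
  have h := (Real.hasDerivAt_sigmoid x).log (Real.sigmoid_pos x).ne'
  convert h using 1
  field_simp [(Real.sigmoid_pos x).ne']

/-! ### Maximum likelihood and projection -/

section Estimation

open Matrix

variable {d M : ℕ} {lam : ℝ} {al am : Fin M → Vec d}

theorem quad_designMatrix (lam : ℝ) (al am : Fin M → Vec d) (u : Vec d) :
    quad (designMatrix lam al am) u = lam * ‖u‖ ^ 2 + ∑ t, ⟪u, al t - am t⟫ ^ 2 := by
  rw [designMatrix, quad_add_matrix, quad_smul_matrix, quad_one, quad_sum_matrix]
  simp_rw [quad_outer]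

theorem posDef_designMatrix (hlam : 0 < lam) (al am : Fin M → Vec d) :
    (designMatrix lam al am).PosDef :=
  (PosDef.one.smul hlam).add_posSemidef (posSemidef_sum _ fun _ _ => posSemidef_outer _)

/-- The first order condition for the regularized likelihood. -/
theorem IsMLE.hMap_eq {y : Fin M → ℝ} {θhat : Vec d} (h : IsMLE lam al am y θhat) :
    hMap lam al am θhat = ∑ t, y t • (al t - am t) := by
  -- `v` is the gradient of the log-likelihood at `θhat`. The derivative along direction `v` is
  -- `‖v‖²`, and it vanishes at a maximizer.
  set v : Vec d := ∑ t, y t • (al t - am t) - hMap lam al am θhat with hv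
  have hlin : ∀ b : Vec d, HasDerivAt (fun s : ℝ => ⟪θhat + s • v, b⟫) ⟪v, b⟫ 0 := fun b => by
    simp_rw [inner_add_left, real_inner_smul_left]
    simpa using ((hasDerivAt_id (0 : ℝ)).mul_const ⟪v, b⟫).const_add ⟪θhat, b⟫
  have hsq : HasDerivAt (fun s : ℝ => ‖θhat + s • v‖ ^ 2) (2 * ⟪θhat, v⟫) 0 := by
    have h1 : HasDerivAt (fun s : ℝ => θhat + s • v) v 0 := by
      simpa using ((hasDerivAt_id (0 : ℝ)).smul_const v).const_add θhat
    simpa using h1.norm_sq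
  have hD : HasDerivAt (fun s : ℝ => logLik lam al am y (θhat + s • v))
      (∑ t, (y t * ((1 - Real.sigmoid ⟪θhat, al t - am t⟫) * ⟪v, al t - am t⟫) +
        (1 - y t) * ((1 - Real.sigmoid (-⟪θhat, al t - am t⟫)) * -⟪v, al t - am t⟫)) -
        lam * (2 * ⟪θhat, v⟫) / 2) 0 := by
    unfold logLik
    refine HasDerivAt.sub (HasDerivAt.fun_sum fun t _ => ?_) ((hsq.const_mul lam).div_const 2)
    have e : ⟪θhat, al t - am t⟫ = ⟪θhat + (0 : ℝ) • v, al t - am t⟫ := by simp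
    rw [e]
    exact (((hasDerivAt_log_sigmoid _).comp (0 : ℝ) (hlin _)).const_mul _).add
      (((hasDerivAt_log_sigmoid _).comp (0 : ℝ) (hlin _).neg).const_mul _)
  have hmax : IsLocalMax (fun s : ℝ => logLik lam al am y (θhat + s • v)) 0 :=
    Filter.Eventually.of_forall fun s => by simpa using h (θhat + s • v)
  have h0 := hmax.hasDerivAt_eq_zero hD
  have hvv : ⟪v, v⟫ = 0 := by
    rw [← h0]
    nth_rewrite 1 [hv]
    rw [hMap, inner_sub_left, inner_add_left, sum_inner, sum_inner, real_inner_smul_left]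
    simp_rw [real_inner_smul_left, Real.sigmoid_neg]
    rw [← sub_sub, sub_right_comm, ← Finset.sum_sub_distrib]
    congr 1
    · exact Finset.sum_congr rfl fun t _ => by rw [real_inner_comm v]; ring
    · ring
  exact (sub_eq_zero.1 (inner_self_eq_zero.1 hvv)).symm

/-- `V ⪰ λ I` gives `‖λ θ‖²_{V⁻¹} ≤ λ ‖θ‖²`. -/
theorem wnorm_inv_smul_le (hlam : 0 < lam) {θ : Vec d} (hθ : ‖θ‖ ≤ 1) :
    wnorm (designMatrix lam al am)⁻¹ (lam • θ) ≤ Real.sqrt lam := by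
  refine Real.sqrt_le_sqrt ?_
  have h := mul_quad_inv_le (posDef_designMatrix hlam al am) PosDef.one hlam.le
    (fun u => by
      rw [quad_one, quad_designMatrix]
      have : 0 ≤ ∑ t, ⟪u, al t - am t⟫ ^ 2 := Finset.sum_nonneg fun _ _ => sq_nonneg _
      linarith) θ
  rw [inv_one, quad_one] at h
  rw [quad_smul]
  have h1 : lam * quad (designMatrix lam al am)⁻¹ θ ≤ 1 :=
    h.trans (pow_le_one₀ (norm_nonneg θ) hθ)
  nlinarith

/-- `H` is strongly monotone on the unit ball with respect to the design matrix. -/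
theorem mul_quad_designMatrix_le (hlam : 0 < lam) (hB : ∀ t, ‖al t - am t‖ ≤ 2) {θ θ' : Vec d}
    (hθ : ‖θ‖ ≤ 1) (hθ' : ‖θ'‖ ≤ 1) :
    100 / 953 * quad (designMatrix lam al am) (θ - θ') ≤
      ⟪hMap lam al am θ - hMap lam al am θ', θ - θ'⟫ := by
  have e : hMap lam al am θ - hMap lam al am θ' = lam • (θ - θ') +
      ∑ t, (Real.sigmoid ⟪θ, al t - am t⟫ - Real.sigmoid ⟪θ', al t - am t⟫) • (al t - am t) := by
    simp only [hMap, smul_sub lam, sub_smul, Finset.sum_sub_distrib]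
    abel
  have habs : ∀ {u : Vec d}, ‖u‖ ≤ 1 → ∀ t, |⟪u, al t - am t⟫| ≤ 2 := fun {u} hu t =>
    (abs_real_inner_le_norm _ _).trans (by nlinarith [hB t, norm_nonneg u, norm_nonneg (al t - am t)])
  rw [e, inner_add_left, real_inner_smul_left, real_inner_self_eq_norm_sq, sum_inner,
    quad_designMatrix, mul_add, Finset.mul_sum]
  refine add_le_add ?_ (Finset.sum_le_sum fun t _ => ?_)
  · nlinarith [mul_nonneg hlam.le (sq_nonneg ‖θ - θ'‖)]
  · have h := mul_sq_sub_le_sigmoid_sub_mul (habs hθ t) (habs hθ' t)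
    rwa [real_inner_smul_left, real_inner_comm (θ - θ'),
      inner_sub_left θ θ']

/-- `953/50` is twice the inverse monotonicity constant. The 2 arises because `θ` itself competes in
the projection, so `H(θP)` is no farther from `H(θhat)` than `H(θ)` is. -/
theorem IsProjectedMLE.wnorm_sub_le (hlam : 0 < lam) (hB : ∀ t, ‖al t - am t‖ ≤ 2)
    {y : Fin M → ℝ} {θ θhat θP : Vec d} (hθ : ‖θ‖ ≤ 1) (hhat : IsMLE lam al am y θhat)
    (hP : IsProjectedMLE lam al am θhat θP) :
    wnorm (designMatrix lam al am) (θ - θP) ≤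
      953 / 50 * (wnorm (designMatrix lam al am)⁻¹ (score θ al am y) + Real.sqrt lam) := by
  set V := designMatrix lam al am with hV
  have hVpd : V.PosDef := posDef_designMatrix hlam al am
  have h1 : hMap lam al am θ - hMap lam al am θhat = lam • θ + -score θ al am y := by
    rw [hhat.hMap_eq, hMap, score]
    simp only [sub_smul, Finset.sum_sub_distrib]
    abel
  have h2 : wnorm V⁻¹ (hMap lam al am θ - hMap lam al am θhat) ≤
      wnorm V⁻¹ (score θ al am y) + Real.sqrt lam := by
    rw [h1]
    refine (hVpd.inv.wnorm_add_le _ _).trans ?_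
    rw [wnorm_neg, add_comm]
    exact add_le_add le_rfl (wnorm_inv_smul_le hlam hθ)
  have h3 : wnorm V⁻¹ (hMap lam al am θ - hMap lam al am θP) ≤
      2 * (wnorm V⁻¹ (score θ al am y) + Real.sqrt lam) := by
    have e : hMap lam al am θ - hMap lam al am θP = (hMap lam al am θ - hMap lam al am θhat) +
        -(hMap lam al am θP - hMap lam al am θhat) := by abel
    rw [e]
    refine (hVpd.inv.wnorm_add_le _ _).trans ?_
    rw [wnorm_neg]
    linarith [hP.2 θ hθ]
  have h4 := (mul_quad_designMatrix_le hlam hB hθ hP.1).trans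
    ((le_abs_self _).trans (hVpd.abs_inner_le _ _))
  rw [← hV, ← hVpd.posSemidef.sq_wnorm] at h4
  rcases (wnorm_nonneg V (θ - θP)).eq_or_lt with h0 | h0
  · rw [← h0]
    have := wnorm_nonneg V⁻¹ (score θ al am y)
    positivity
  · have h5 : 100 / 953 * wnorm V (θ - θP) ≤ wnorm V⁻¹ (hMap lam al am θ - hMap lam al am θP) := by
      refine le_of_mul_le_mul_right ?_ h0
      linarith
    linarith

end Estimation

/-! ### The design matrix of the selected pairs -/

section Selection

variable {d N T M : ℕ} {A : Fin N → Finset (Vec d)} {πhat : diffs A → ℝ} {al am : Fin M → Vec d}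

theorem sub_mem_diffs {n : Fin N} {a a' : Vec d} (ha : a ∈ A n) (ha' : a' ∈ A n) :
    a - a' ∈ diffs A := by
  classical
  simp only [diffs, Finset.mem_biUnion, Finset.mem_image, Finset.mem_product, Prod.exists]
  exact ⟨n, Finset.mem_univ _, a, a', ⟨ha, ha'⟩, rfl⟩

theorem IsSelected.norm_sub_le (hsel : IsSelected A T πhat al am)
    (hA : ∀ n, ∀ a ∈ A n, ‖a‖ ≤ 1) (t : Fin M) : ‖al t - am t‖ ≤ 2 := by
  obtain ⟨n, h1, h2⟩ := hsel.1 t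
  refine (_root_.norm_sub_le _ _).trans ?_
  linarith [hA n _ h1, hA n _ h2]

/-- Grouping rounds by their difference, each `b` contributes `⌈T πhat(b)⌉ ≥ T πhat(b)` copies of `b
bᵀ`. -/
theorem IsSelected.mul_quad_infoMatrix_le (hsel : IsSelected A T πhat al am) {lam : ℝ}
    (hlam : 0 ≤ lam) (u : Vec d) :
    T * quad (infoMatrix πhat) u ≤ quad (designMatrix lam al am) u := by
  classical
  have hmem : ∀ t, al t - am t ∈ diffs A := fun t => by
    obtain ⟨n, h1, h2⟩ := hsel.1 t
    exact sub_mem_diffs h1 h2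
  have hfib := Finset.sum_fiberwise Finset.univ (fun t => (⟨al t - am t, hmem t⟩ : diffs A))
    fun t => ⟪u, al t - am t⟫ ^ 2
  rw [quad_designMatrix, quad_infoMatrix, ← hfib, Finset.mul_sum]
  refine le_add_of_nonneg_of_le (by positivity) (Finset.sum_le_sum fun b _ => ?_)
  have hcard := hsel.2 b
  rw [Finset.sum_congr rfl fun t ht => by
    rw [show al t - am t = (b : Vec d) from congrArg Subtype.val (Finset.mem_filter.1 ht).2],
    Finset.sum_const, nsmul_eq_mul, ← mul_assoc]
  refine mul_le_mul_of_nonneg_right ?_ (sq_nonneg _)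
  simp only [Subtype.ext_iff]
  refine (Nat.le_ceil _).trans_eq ?_
  rw [← hcard]

end Selection

/-! ### Numerical estimates -/

theorem log_four_thirds_le : Real.log (4 / 3) ≤ 3 / 10 := by
  rw [Real.log_le_iff_le_exp (by norm_num)]
  have := Real.quadratic_le_exp_of_nonneg (x := 3 / 10) (by norm_num)
  linarith

/-- The case `d = 1`, where the stated logarithm may fall below `log(4/3)`. That forces `λ` to be
large, and the spare `0.94 √λ` on the right then pays for the deficit. -/
theorem mul_sqrt_add_sqrt_le {lam l L : ℝ} (hlam : 0 < lam) (hl : 0 ≤ l)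
    (hL : Real.log (1 + 4 / lam) ≤ L) :
    953 / 50 * (Real.sqrt (2 * l + 3 / 10) + Real.sqrt lam) ≤
      20 * (Real.sqrt (2 * l + L) + Real.sqrt lam) := by
  set s := Real.sqrt lam with hs
  have hs0 : 0 < s := Real.sqrt_pos.2 hlam
  have hs2 : s ^ 2 = lam := Real.sq_sqrt hlam.le
  rcases le_or_gt (3 / 10) L with h | h
  · have := Real.sqrt_le_sqrt (show 2 * l + 3 / 10 ≤ 2 * l + L by linarith)
    have := Real.sqrt_nonneg (2 * l + 3 / 10)
    linarith
  have h1 : 4 / (lam + 4) ≤ L := by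
    have h2 := Real.one_sub_inv_le_log_of_pos (show 0 < 1 + 4 / lam by positivity)
    have e : 1 - (1 + 4 / lam)⁻¹ = 4 / (lam + 4) := by field_simp; ring
    linarith
  have hlam9 : 9.3 ≤ lam := by
    have := h1.trans h.le
    rw [div_le_iff₀ (by linarith)] at this
    linarith
  have hL0 : 0 < L := lt_of_lt_of_le (by positivity) h1
  set C := Real.sqrt L with hC
  set a := Real.sqrt (2 * l + L) with ha
  set D := Real.sqrt (3 / 10) with hD
  have hC2 : C ^ 2 = L := Real.sq_sqrt hL0.le
  have hD2 : D ^ 2 = 3 / 10 := Real.sq_sqrt (by norm_num)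
  have ha2 : a ^ 2 = 2 * l + L := Real.sq_sqrt (by linarith)
  have hCD : C ≤ D := Real.sqrt_le_sqrt h.le
  have hCa : C ≤ a := Real.sqrt_le_sqrt (by linarith)
  have hC0 : 0 ≤ C := Real.sqrt_nonneg _
  -- `1.67² / λ ≤ 4 / (λ + 4)` already holds for `λ ≥ 9.3`.
  have hCs : 1.67 / s ≤ C := by
    refine Real.le_sqrt_of_sq_le (le_trans ?_ h1)
    rw [div_pow, hs2, div_le_div_iff₀ hlam (by linarith)]
    linarith
  have hDle : D ≤ 0.548 := Real.sqrt_le_iff.2 ⟨by norm_num, by norm_num⟩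
  have hsqrt : Real.sqrt (2 * l + 3 / 10) ≤ a + (D - C) := by
    refine Real.sqrt_le_iff.2 ⟨by linarith, ?_⟩
    nlinarith [mul_nonneg (sub_nonneg.2 hCa) (sub_nonneg.2 hCD)]
  -- Since `C ≤ a`, the goal reduces to `19.06 D ≤ 20 C + 0.94 s`, and `19.06 * 0.548 < 10.446`. The
  -- point `5.55` is close to the vertex of the resulting quadratic in `s`.
  have hnum : 10.446 ≤ 20 * (1.67 / s) + 0.94 * s := by
    have e : 20 * (1.67 / s) + 0.94 * s = (33.4 + 0.94 * s ^ 2) / s := by field_simp; ring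
    rw [e, le_div_iff₀ hs0]
    nlinarith [sq_nonneg (s - 5.55)]
  linarith

/-- The argument of the logarithm is `(λ + 4t/d) / λ^{1/d}`. It is at least 4, since `4t/d ≥ 4d ≥ 8`
and `λ^{1/d} ≤ max(1, √λ)`. -/
theorem le_log_of_two_le {d : ℕ} (hd : 2 ≤ d) {lam t : ℝ} (hlam : 0 < lam)
    (ht : (d : ℝ) ^ 2 ≤ t) :
    3 / 10 ≤ Real.log (lam ^ (1 - 1 / (d : ℝ)) + 4 * t / ((d : ℝ) * lam ^ (1 / (d : ℝ)))) := by
  have hd2 : (2 : ℝ) ≤ d := by exact_mod_cast hd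
  set a := lam ^ (1 / (d : ℝ)) with ha
  have ha0 : 0 < a := Real.rpow_pos_of_pos hlam _
  have he : 1 / (d : ℝ) ≤ 1 / 2 := one_div_le_one_div_of_le (by norm_num) hd2
  rw [Real.rpow_sub hlam, Real.rpow_one, ← ha]
  have hs2 := Real.sq_sqrt hlam.le
  have ha4 : 4 * a ≤ lam + 8 := by
    rcases le_total lam 1 with h | h
    · have : a ≤ 1 := Real.rpow_le_one hlam.le h (by positivity)
      linarith
    · have : a ≤ Real.sqrt lam := by
        rw [Real.sqrt_eq_rpow]
        exact Real.rpow_le_rpow_of_exponent_le h he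
      nlinarith [sq_nonneg (Real.sqrt lam - 2)]
  have h8 : 8 ≤ 4 * t / d := by
    rw [le_div_iff₀ (by linarith)]
    nlinarith
  have h4 : 4 ≤ lam / a + 4 * t / (d * a) := by
    rw [← div_div, ← add_div, le_div_iff₀ ha0]
    linarith
  have := Real.log_le_log (by norm_num) h4
  have := Real.one_sub_inv_le_log_of_pos (show (0 : ℝ) < 4 by norm_num)
  norm_num at this
  linarith

theorem confidence_width_le {d : ℕ} (hd : 0 < d) {lam t l : ℝ} (hlam : 0 < lam)
    (ht : (d : ℝ) ^ 2 ≤ t) (hl : 0 ≤ l) :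
    953 / 50 * (Real.sqrt (2 * l + d * Real.log (4 / 3)) + Real.sqrt lam) ≤
      20 * (Real.sqrt (2 * l + d * Real.log (lam ^ (1 - 1 / (d : ℝ)) +
        4 * t / ((d : ℝ) * lam ^ (1 / (d : ℝ))))) + Real.sqrt lam) := by
  have hlog := log_four_thirds_le
  obtain rfl | hd2 : d = 1 ∨ 2 ≤ d := by omega
  · have h1 : 1 ≤ t := by simpa using ht
    refine le_trans ?_ (mul_sqrt_add_sqrt_le hlam hl ?_)
    · have := Real.sqrt_le_sqrt (show 2 * l + ((1 : ℕ) : ℝ) * Real.log (4 / 3) ≤ 2 * l + 3 / 10 by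
        push_cast; linarith)
      linarith
    · simp only [Nat.cast_one, div_one, sub_self, Real.rpow_zero, Real.rpow_one, one_mul]
      refine Real.log_le_log (by positivity) ?_
      have : 4 / lam ≤ 4 * t / lam := div_le_div_of_nonneg_right (by linarith) hlam.le
      linarith
  · have h := le_log_of_two_le hd2 hlam ht
    have hs := Real.sqrt_le_sqrt (add_le_add_right
      (mul_le_mul_of_nonneg_left (hlog.trans h) d.cast_nonneg) (2 * l))
    have := Real.sqrt_nonneg (2 * l + d * Real.log (4 / 3))
    have := Real.sqrt_nonneg lam
    linarith

theorem IsGreedy.simpleRegret_le {d N : ℕ} {A : Fin N → Finset (Vec d)} {θ θP : Vec d}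
    {ahat : Fin N → Vec d} (h : IsGreedy A θP ahat) {V : Matrix (Fin d) (Fin d) ℝ} (hV : V.PosDef)
    {c : ℝ} (hc : 0 ≤ c) (hdiff : ∀ b ∈ diffs A, wnorm V⁻¹ b ≤ c) :
    simpleRegret A θ ahat ≤ c * wnorm V (θ - θP) := by
  -- `Real.iSup_le` requires a nonnegative bound, because an empty real supremum is 0.
  have h0 : 0 ≤ c * wnorm V (θ - θP) := mul_nonneg hc (wnorm_nonneg _ _)
  refine Real.iSup_le (fun n => Real.iSup_le (fun a => ?_) h0) h0
  have h1 : ⟪θP, (a : Vec d) - ahat n⟫ ≤ 0 := by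
    rw [inner_sub_right]
    linarith [(h n).2 a a.2]
  have h2 : ⟪θ, (a : Vec d) - ahat n⟫ =
      ⟪(a : Vec d) - ahat n, θ - θP⟫ + ⟪θP, (a : Vec d) - ahat n⟫ := by
    rw [real_inner_comm (θ - θP), inner_sub_left]
    ring
  have h3 := (le_abs_self _).trans (hV.abs_inner_le ((a : Vec d) - ahat n) (θ - θP))
  have h4 := mul_le_mul_of_nonneg_right (hdiff _ (sub_mem_diffs a.2 (h n).1))
    (wnorm_nonneg V (θ - θP))
  linarith

end ODPO

theorem theorem1
    {d N T m : ℕ} (hd : 0 < d) (hT : d ^ 2 ≤ T)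
    (lam ε δ : ℝ) (hlam : 0 < lam) (hε : 0 < ε) (hδ0 : 0 < δ) (hδ1 : δ < 1)
    -- action sets and true parameter in the unit ball
    (A : Fin N → Finset (ODPO.Vec d)) (hA : ∀ n, (A n).Nonempty)
    (hAball : ∀ n, ∀ a ∈ A n, ‖a‖ ≤ 1)
    (hspan : Submodule.span ℝ (ODPO.diffs A : Set (ODPO.Vec d)) = ⊤)
    (θstar : ODPO.Vec d) (hθstar : ‖θstar‖ ≤ 1)
    -- the optimal design, its approximation and the dataset selected by ODPO
    (πstar πhat : ODPO.diffs A → ℝ) (hπstar : ODPO.IsOptimalDesign πstar)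
    (hπhat : ODPO.IsApproxDesign ε πstar πhat)
    (al am : Fin m → ODPO.Vec d) (hsel : ODPO.IsSelected A T πhat al am)
    -- the random labels
    {Ω : Type*} [mΩ : MeasurableSpace Ω] (P : Measure Ω) [IsProbabilityMeasure P]
    (ℱ : Filtration ℕ mΩ) (Y : Fin m → Ω → ℝ)
    (hY : ODPO.IsPreferenceFeedback P ℱ θstar al am Y) :
    ENNReal.ofReal (1 - δ) ≤
      P {ω | ∀ (θhat θP : ODPO.Vec d) (ahat : Fin N → ODPO.Vec d),
        ODPO.IsMLE lam al am (fun t => Y t ω) θhat →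
        ODPO.IsProjectedMLE lam al am θhat θP →
        ODPO.IsGreedy A θP ahat →
        ODPO.simpleRegret A θstar ahat ≤
          20 * (1 + ε) * Real.sqrt ((d : ℝ) / T) *
            (Real.sqrt (2 * Real.log (1 / δ) +
                d * Real.log (lam ^ (1 - 1 / (d : ℝ)) +
                  4 * (T : ℝ) / ((d : ℝ) * lam ^ (1 / (d : ℝ))))) +
              Real.sqrt lam)} := by
  have hd2 : (d : ℝ) ^ 2 ≤ T := by exact_mod_cast hT
  have hdpos : (0 : ℝ) < d := by exact_mod_cast hd
  have hTpos : (0 : ℝ) < T := lt_of_lt_of_le (by positivity) hd2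
  have hl : 0 ≤ Real.log (1 / δ) := Real.log_nonneg ((one_le_div hδ0).2 hδ1.le)
  obtain ⟨hWpd, hWq⟩ := hπhat.posDef_and_quad_le hd hspan hε hπstar
  have hVpd := ODPO.posDef_designMatrix hlam al am
  have hdiff : ∀ b ∈ ODPO.diffs A, ODPO.wnorm (ODPO.designMatrix lam al am)⁻¹ b ≤
      (1 + ε) * Real.sqrt ((d : ℝ) / T) := fun b hb => by
    have h1 := (ODPO.mul_quad_inv_le hVpd hWpd hTpos.le
      (hsel.mul_quad_infoMatrix_le hlam.le) b).trans (hWq b hb)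
    have h2 : ODPO.quad (ODPO.designMatrix lam al am)⁻¹ b ≤ (1 + ε) * (d / T) := by
      rw [← mul_div_assoc, le_div_iff₀ hTpos]
      linarith
    refine Real.sqrt_le_iff.2 ⟨by positivity, h2.trans ?_⟩
    rw [mul_pow, Real.sq_sqrt (by positivity)]
    -- Here `1 + ε ≤ (1 + ε)²`: the sharper factor `√(1 + ε)` is given up.
    exact mul_le_mul_of_nonneg_right (by nlinarith) (by positivity)
  -- On the score event the rest is deterministic and holds for every choice of maximizers, so
  -- monotonicity of the measure suffices and the target event need not be measurable.
  refine (hY.le_measure_quad_score_le hVpd (fun u => ?_) hδ0).trans (measure_mono ?_)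
  · rw [ODPO.quad_designMatrix]
    exact le_add_of_nonneg_left (by positivity)
  · intro ω hω θhat θP ahat hMLE hP hgreedy
    have hscore := Real.sqrt_le_sqrt (Set.mem_ofPred_eq ▸ hω)
    have hest := hP.wnorm_sub_le hlam (hsel.norm_sub_le hAball) hθstar hMLE
    have hwidth := ODPO.confidence_width_le hd hlam hd2 hl
    refine (hgreedy.simpleRegret_le hVpd (by positivity) hdiff).trans ?_
    refine (mul_le_mul_of_nonneg_left (hest.trans ((mul_le_mul_of_nonneg_left
      (add_le_add hscore le_rfl) (by norm_num)).trans hwidth)) (by positivity)).trans_eq ?_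
    ring
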